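/- **Setting.** Let $\pi:Q\to\mathbb R$ be a smooth fibre bundle over the time axis, with fibres of dimension $m$ and fibred coordinates $(t,q^i)$, $i=1,\dots,m$. Let $J^1Q$ be its first order jet manifold (velocity space) with coordinates $(t,q^i,q^i_t)$, and let $V^*Q$ be the vertical cotangent bundle (phase space) with coordinates $(t,q^i,p_i)$. All objects are of class $C^\infty$. Sections over $\mathbb R$ may be local, i.e. defined on an open set $U\subset\mathbb R$. Let $L=\mathcal L\,dt$ with $\mathcal L:J^1Q\to\mathbb R$ be a Lagrangian, and put $\pi_i=\partial\mathcal L/\partial q^i_t$. Its Legendre map $\widehat L:J^1Q\to V^*Q$ over $Q$ is given by $p_i\circ\widehat L=\pi_i$, and its Lagrangian constraint space is $N_L=\widehat L(J^1Q)$. The Lagrangian $L$ is *almost regular* if $N_L$ is a closed imbedded subbundle of $V^*Q\to Q$ and $\widehat L:J^1Q\to N_L$ is a surjective submersion with connected fibres. A *Hamiltonian form* on $V^*Q$ is the pull-back $H=p_k\,dq^k-\mathcal H\,dt$ of the Liouville form by a global section $p_0=-\mathcal H(t,q^j,p_j)$ of the bundle $T^*Q\to V^*Q$. It defines the Hamiltonian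 map $\widehat H:V^*Q\to J^1Q$ over $Q$, $q^i_t\circ\widehat H=\partial\mathcal H/\partial p_i$, and the Lagrangian $L_H=(p_iq^i_t-\mathcal H)\,dt$. The form $H$ is *weakly associated* with $L$ if $\widehat L\circ\widehat H\circ\widehat L=\widehat L$ and if $\widehat H^*L_H=\widehat H^*L$ holds at the points of $N_L$, that is, $$p_i\frac{\partial\mathcal H}{\partial p_i}-\mathcal H=\mathcal L\Bigl(t,q^j,\frac{\partial\mathcal H}{\partial p_j}\Bigr)\quad\text{on } N_L .$$ **Theorem 3.3.** Let $H$ be a Hamiltonian form weakly associated with an almost regular Lagrangian $L$, and let a section $r$ of $V^*Q\to\mathbb R$ be a solution of the Hamilton equation $$\dot q^i=\frac{\partial\mathcal H}{\partial p_i},\qquad \dot p_i=-\frac{\partial\mathcal H}{\partial q^i}.$$ Suppose that $r$ takes its values in $N_L$. Then: 1. The projection $s$ of $r$ to $Q$ is a section of $Q\to\mathbb R$ that satisfies the Lagrange equation $$\frac{\partial\mathcal L}{\partial q^i}(t,s,\dot s)-\frac{d}{dt}\bigl(\pi_i(t,s,\dot s)\bigr)=0 .$$ 2. The map $\overline s=\widehat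 H\circ r$ is a section of $J^1Q\to\mathbb R$, $\overline s(t)=(t,q^i(t),v^i(t))$, that satisfies the Cartan equation $$\frac{\partial\pi_j}{\partial q^i_t}\,(\dot q^j-v^j)=0,\qquad \frac{\partial\mathcal L}{\partial q^i}-\frac{d}{dt}\pi_i+\frac{\partial\pi_j}{\partial q^i}\,(\dot q^j-v^j)=0,$$ where $\mathcal L$, $\pi_i$ and their partial derivatives are evaluated along $\overline s$. -/

import Mathlib

open scoped Manifold ContDiff

noncomputable section

namespace TimeMech

universe u

/-- The coordinate space of the fibre coordinates `q^i`, `q^i_t` or `p_i`, `i = 1, ..., m`. -/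
abbrev Eu (m : ℕ) : Type := EuclideanSpace ℝ (Fin m)

/-- `p : Y → X` is a smooth fibre bundle: a surjection which is locally trivial, through
diffeomorphisms over `X`, with a typical fibre `F` that is a smooth manifold of dimension `k`. -/
def IsSmoothFibreBundle {X EX HX EY HY : Type*} {Y : Type u}
    [NormedAddCommGroup EX] [NormedSpace ℝ EX] [TopologicalSpace HX]
    [NormedAddCommGroup EY] [NormedSpace ℝ EY] [TopologicalSpace HY]
    [TopologicalSpace X] [ChartedSpace HX X] [TopologicalSpace Y] [ChartedSpace HY Y]
    (IX : ModelWithCorners ℝ EX HX) (IY : ModelWithCorners ℝ EY HY) (k : ℕ) (p : Y → X) : Prop :=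
  Function.Surjective p ∧
  ∃ (F : Type u) (_ : TopologicalSpace F) (_ : ChartedSpace (Eu k) F),
    IsManifold 𝓘(ℝ, Eu k) ∞ F ∧
    ∀ x : X, ∃ e : Bundle.Trivialization F p, x ∈ e.baseSet ∧
      ContMDiffOn IY (IX.prod 𝓘(ℝ, Eu k)) ∞ e e.source ∧
      ContMDiffOn (IX.prod 𝓘(ℝ, Eu k)) IY ∞ e.toOpenPartialHomeomorph.symm e.target

section Config

variable (m : ℕ) {Q : Type u} [TopologicalSpace Q] [ChartedSpace (ℝ × Eu m) Q]

/-- `π : Q → ℝ` is a smooth fibre bundle over the time axis, with fibres of dimension `m`. -/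
class ConfigBundle (π : Q → ℝ) : Prop where
  isBundle : IsSmoothFibreBundle 𝓘(ℝ, ℝ) 𝓘(ℝ, ℝ × Eu m) m π

/-- A system of fibred coordinates `(t, q^i)` on an open subset of `Q`, that is, a smooth chart
whose first coordinate is the time `π`. -/
structure BundleChart (π : Q → ℝ) extends OpenPartialHomeomorph Q (ℝ × Eu m) where
  smooth : ContMDiffOn 𝓘(ℝ, ℝ × Eu m) 𝓘(ℝ, ℝ × Eu m) ∞ toFun source
  smooth_symm : ContMDiffOn 𝓘(ℝ, ℝ × Eu m) 𝓘(ℝ, ℝ × Eu m) ∞ invFun target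
  time : ∀ x ∈ source, (toFun x).1 = π x

variable (π : Q → ℝ)

theorem exists_bundleChart [h : ConfigBundle m π] (q : Q) :
    ∃ φ : BundleChart m π, q ∈ φ.source := by
  obtain ⟨-, F, _, _, hF, hloc⟩ := h.isBundle
  obtain ⟨e, hq, h1, h2⟩ := hloc (π q)
  have hqs : q ∈ e.source := e.mem_source.2 hq
  let c := chartAt (Eu m) (e q).2
  let ψ : OpenPartialHomeomorph (ℝ × F) (ℝ × Eu m) := (OpenPartialHomeomorph.refl ℝ).prod c
  have hψ : ContMDiffOn (𝓘(ℝ, ℝ).prod 𝓘(ℝ, Eu m)) 𝓘(ℝ, ℝ × Eu m) ∞ ψ ψ.source := by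
    have : ContMDiffOn (𝓘(ℝ, ℝ).prod 𝓘(ℝ, Eu m)) (𝓘(ℝ, ℝ).prod 𝓘(ℝ, Eu m)) ∞
        (Prod.map (id : ℝ → ℝ) c) (Set.univ ×ˢ c.source) :=
      contMDiffOn_id.prodMap (contMDiffOn_chart (I := 𝓘(ℝ, Eu m)))
    rw [modelWithCornersSelf_prod, ← chartedSpaceSelf_prod]
    exact this
  have hψ' : ContMDiffOn 𝓘(ℝ, ℝ × Eu m) (𝓘(ℝ, ℝ).prod 𝓘(ℝ, Eu m)) ∞ ψ.symm ψ.target := by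
    have : ContMDiffOn (𝓘(ℝ, ℝ).prod 𝓘(ℝ, Eu m)) (𝓘(ℝ, ℝ).prod 𝓘(ℝ, Eu m)) ∞
        (Prod.map (id : ℝ → ℝ) c.symm) (Set.univ ×ˢ c.target) :=
      contMDiffOn_id.prodMap (contMDiffOn_chart_symm (I := 𝓘(ℝ, Eu m)))
    rw [modelWithCornersSelf_prod, ← chartedSpaceSelf_prod]
    exact this
  refine ⟨⟨e.toOpenPartialHomeomorph.trans ψ, ?_, ?_, ?_⟩, ?_⟩
  · exact hψ.comp' h1
  · have := h2.comp' hψ'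
    refine this.mono ?_
    intro x hx
    exact ⟨hx.1, hx.2⟩
  · intro x hx
    exact e.proj_toFun x hx.1
  · refine ⟨hqs, ?_⟩
    exact ⟨trivial, mem_chart_source _ _⟩

variable {m π}

/-- Some system of fibred coordinates around `q`. -/
def chartOf [ConfigBundle m π] (q : Q) : BundleChart m π := (exists_bundleChart m π q).choose

theorem mem_chartOf_source [ConfigBundle m π] (q : Q) :
    q ∈ (chartOf q : BundleChart m π).source := (exists_bundleChart m π q).choose_spec

variable (m π)

/-- The one-form `dt` on `Q`, that is, the differential of `π`. -/
def dt (q : Q) : TangentSpace 𝓘(ℝ, ℝ × Eu m) q →L[ℝ] ℝ :=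
  mfderiv 𝓘(ℝ, ℝ × Eu m) 𝓘(ℝ, ℝ) π q

/-- The vertical tangent space `V_q Q`. -/
abbrev Vert (q : Q) : Submodule ℝ (TangentSpace 𝓘(ℝ, ℝ × Eu m) q) := (dt m π q).ker

/-- The velocity space `J¹Q`. A first order jet at `q` of sections of `Q → ℝ` is identified with
the tangent vector `∂_t + q^i_t ∂_i` at `q` of these sections, i.e. with a vector `v` such that
`dt v = 1`. -/
@[ext]
structure Jet1 where
  pt : Q
  vec : TangentSpace 𝓘(ℝ, ℝ × Eu m) pt
  dt_vec : dt m π pt vec = 1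

/-- The phase space `V*Q`: the vertical cotangent bundle, whose points are linear forms on the
vertical tangent spaces. -/
@[ext]
structure VDual where
  pt : Q
  cov : Vert m π pt →L[ℝ] ℝ

variable {m π}

namespace BundleChart

variable (φ : BundleChart m π)

/-- The components `(v^t, v^i)` of tangent vectors `v` at `q` in the coordinates `φ`. -/
def tan (q : Q) : TangentSpace 𝓘(ℝ, ℝ × Eu m) q →L[ℝ] ℝ × Eu m :=
  mfderiv 𝓘(ℝ, ℝ × Eu m) 𝓘(ℝ, ℝ × Eu m) φ.toOpenPartialHomeomorph q

open Classical in
/-- The holonomic frame at `q`: `φ.frame q (a, w) = a ∂_t + w^i ∂_i` for `q` in the domain of the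
coordinates (and `0` elsewhere). -/
def frame (q : Q) : (ℝ × Eu m) →L[ℝ] TangentSpace 𝓘(ℝ, ℝ × Eu m) q :=
  if q ∈ φ.source then (φ.tan q).inverse else 0

theorem mdiff : φ.toOpenPartialHomeomorph.MDifferentiable 𝓘(ℝ, ℝ × Eu m) 𝓘(ℝ, ℝ × Eu m) :=
  ⟨φ.smooth.mdifferentiableOn (by simp), φ.smooth_symm.mdifferentiableOn (by simp)⟩

theorem tan_isInvertible {q : Q} (hq : q ∈ φ.source) : (φ.tan q).IsInvertible :=
  ⟨φ.mdiff.mfderiv hq, rfl⟩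

@[simp] theorem tan_frame {q : Q} (hq : q ∈ φ.source) (w : ℝ × Eu m) :
    φ.tan q (φ.frame q w) = w := by
  rw [frame, if_pos hq]; exact (φ.tan_isInvertible hq).self_apply_inverse w

@[simp] theorem frame_tan {q : Q} (hq : q ∈ φ.source) (w : TangentSpace 𝓘(ℝ, ℝ × Eu m) q) :
    φ.frame q (φ.tan q w) = w := by
  rw [frame, if_pos hq]; exact (φ.tan_isInvertible hq).inverse_apply_self w

theorem tan_fst {q : Q} (hq : q ∈ φ.source) (w : TangentSpace 𝓘(ℝ, ℝ × Eu m) q) :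
    (φ.tan q w).1 = dt m π q w := by
  have h1 : π =ᶠ[nhds q] (ContinuousLinearMap.fst ℝ ℝ (Eu m)) ∘ φ.toOpenPartialHomeomorph := by
    filter_upwards [φ.open_source.mem_nhds hq] with x hx
    exact (φ.time x hx).symm
  unfold dt
  rw [h1.mfderiv_eq, mfderiv_comp q
    (ContinuousLinearMap.fst ℝ ℝ (Eu m)).differentiableAt.mdifferentiableAt
    (φ.mdiff.mdifferentiableAt hq)]
  rw [mfderiv_eq_fderiv, ContinuousLinearMap.fderiv]
  rfl

theorem dt_frame {q : Q} (hq : q ∈ φ.source) (w : ℝ × Eu m) :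
    dt m π q (φ.frame q w) = w.1 := by
  rw [← φ.tan_fst hq, φ.tan_frame hq]

theorem dt_frame_vert (q : Q) (w : Eu m) : dt m π q (φ.frame q (0, w)) = 0 := by
  by_cases hq : q ∈ φ.source
  · exact φ.dt_frame hq _
  · simp [frame, hq]


section Transition

variable (ψ : BundleChart m π)

/-- The transition functions between two systems of fibred coordinates. -/
def trans : ℝ × Eu m → ℝ × Eu m := ψ.toOpenPartialHomeomorph ∘ φ.toOpenPartialHomeomorph.symm

/-- The coordinate domain on which `φ.trans ψ` is a change of coordinates. -/
def overlap : Set (ℝ × Eu m) :=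
  (φ.toOpenPartialHomeomorph.symm.trans ψ.toOpenPartialHomeomorph).source

theorem isOpen_overlap : IsOpen (φ.overlap ψ) := OpenPartialHomeomorph.open_source _

theorem mem_overlap {x : ℝ × Eu m} : x ∈ φ.overlap ψ ↔
    x ∈ φ.target ∧ φ.toOpenPartialHomeomorph.symm x ∈ ψ.source := by
  simp [overlap]

theorem contDiffOn_trans : ContDiffOn ℝ ∞ (φ.trans ψ) (φ.overlap ψ) := by
  rw [← contMDiffOn_iff_contDiffOn]
  have := ψ.smooth.comp' φ.smooth_symm
  exact this.mono fun x hx => ⟨hx.1, hx.2⟩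

theorem trans_apply {q : Q} (hq : q ∈ φ.source) :
    φ.trans ψ (φ.toOpenPartialHomeomorph q) = ψ.toOpenPartialHomeomorph q := by
  simp [trans, φ.left_inv hq]

theorem tan_frame_trans {q : Q} (hφ : q ∈ φ.source) (hψ : q ∈ ψ.source) (w : ℝ × Eu m) :
    ψ.tan q (φ.frame q w) = fderiv ℝ (φ.trans ψ) (φ.toOpenPartialHomeomorph q) w := by
  have hmem : φ.toOpenPartialHomeomorph q ∈ φ.overlap ψ := by
    rw [mem_overlap]; exact ⟨φ.map_source hφ, by rwa [φ.left_inv hφ]⟩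
  have hd : DifferentiableAt ℝ (φ.trans ψ) (φ.toOpenPartialHomeomorph q) :=
    ((φ.contDiffOn_trans ψ).contDiffAt ((φ.isOpen_overlap ψ).mem_nhds hmem)).differentiableAt
      (by simp)
  have h1 : ψ.toOpenPartialHomeomorph =ᶠ[nhds q] φ.trans ψ ∘ φ.toOpenPartialHomeomorph := by
    filter_upwards [φ.open_source.mem_nhds hφ] with x hx
    exact (φ.trans_apply ψ hx).symm
  have h2 : ψ.tan q = (fderiv ℝ (φ.trans ψ) (φ.toOpenPartialHomeomorph q)).comp (φ.tan q) := by
    unfold tan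
    rw [h1.mfderiv_eq, mfderiv_comp q hd.mdifferentiableAt (φ.mdiff.mdifferentiableAt hφ),
      mfderiv_eq_fderiv]
    rfl
  rw [h2]
  simp only [ContinuousLinearMap.comp_apply, φ.tan_frame hφ]

end Transition

end BundleChart

theorem nonempty_jet [ConfigBundle m π] (q : Q) : ∃ v, dt m π q v = 1 :=
  ⟨(chartOf q : BundleChart m π).frame q (1, 0),
    BundleChart.dt_frame _ (mem_chartOf_source q) _⟩

namespace BundleChart

variable (φ ψ : BundleChart m π)

open Classical in
/-- The adapted coordinates `(t, q^i, q^i_t)` on the velocity space. -/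
def jet [ConfigBundle m π] : PartialEquiv (Jet1 m π) ((ℝ × Eu m) × Eu m) where
  toFun j := (φ.toOpenPartialHomeomorph j.pt, (φ.tan j.pt j.vec).2)
  invFun y :=
    let q := φ.toOpenPartialHomeomorph.symm y.1
    if h : q ∈ φ.source then ⟨q, φ.frame q (1, y.2), φ.dt_frame h _⟩
    else ⟨q, (nonempty_jet q).choose, (nonempty_jet q).choose_spec⟩
  source := {j | j.pt ∈ φ.source}
  target := φ.target ×ˢ Set.univ
  map_source' j hj := ⟨φ.map_source hj, trivial⟩
  map_target' y hy := by
    have := φ.map_target hy.1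
    simp only [Set.mem_ofPred_eq]
    split_ifs
    exact this
  left_inv' j hj := by
    have key : ∀ q (h : q = j.pt) (h' : q ∈ φ.source),
        (⟨q, φ.frame q (1, (φ.tan j.pt j.vec).2), φ.dt_frame h' _⟩ : Jet1 m π) = j := by
      rintro _ rfl h'
      ext1
      · rfl
      · have : ((1 : ℝ), (φ.tan j.pt j.vec).2) = φ.tan j.pt j.vec := by
          ext1
          · rw [φ.tan_fst h', j.dt_vec]
          · rfl
        change φ.frame j.pt ((1 : ℝ), (φ.tan j.pt j.vec).2) = j.vec
        rw [this, φ.frame_tan h']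
    have h' := φ.map_target (φ.map_source hj)
    simp only
    rw [dif_pos h']
    exact key _ (φ.left_inv hj) h'
  right_inv' y hy := by
    have h' := φ.map_target hy.1
    simp only
    rw [dif_pos h']
    simp only [φ.tan_frame h']
    ext1
    · exact φ.right_inv hy.1
    · rfl

/-- The holonomic vertical frame: `φ.vert q w = w^i ∂_i`. -/
def vert (q : Q) : Eu m →L[ℝ] Vert m π q :=
  ((φ.frame q).comp (ContinuousLinearMap.inr ℝ ℝ (Eu m))).codRestrict _
    fun w => φ.dt_frame_vert q w

/-- The components `w^i` of vertical tangent vectors `w` at `q` in the coordinates `φ`. -/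
def vertCoord (q : Q) : Vert m π q →L[ℝ] Eu m :=
  (ContinuousLinearMap.snd ℝ ℝ (Eu m)).comp ((φ.tan q).comp (Vert m π q).subtypeL)

theorem vertCoord_vert {q : Q} (hq : q ∈ φ.source) (w : Eu m) :
    φ.vertCoord q (φ.vert q w) = w := by
  change (φ.tan q (φ.frame q (0, w))).2 = w
  rw [φ.tan_frame hq]

theorem vert_vertCoord {q : Q} (hq : q ∈ φ.source) (w : Vert m π q) :
    φ.vert q (φ.vertCoord q w) = w := by
  ext1
  change φ.frame q (0, (φ.tan q w).2) = w
  have : ((0 : ℝ), (φ.tan q w).2) = φ.tan q w := by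
    ext1
    · rw [φ.tan_fst hq]; exact w.2.symm
    · rfl
  rw [this, φ.frame_tan hq]

/-- The components `p_i = α(∂_i)` of a vertical covector `α` at `q`. -/
def momentum (q : Q) (α : Vert m π q →L[ℝ] ℝ) : Eu m :=
  WithLp.toLp 2 fun i => α (φ.vert q (EuclideanSpace.single i 1))

/-- The vertical covector at `q` with components `p_i`. -/
def covector (q : Q) (p : Eu m) : Vert m π q →L[ℝ] ℝ := (innerSL ℝ p).comp (φ.vertCoord q)

theorem covector_apply (q : Q) (p : Eu m) (w : Vert m π q) :
    φ.covector q p w = inner ℝ p (φ.vertCoord q w) := rfl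

theorem momentum_covector {q : Q} (hq : q ∈ φ.source) (p : Eu m) :
    φ.momentum q (φ.covector q p) = p := by
  ext i
  change φ.covector q p _ = p i
  rw [covector_apply, φ.vertCoord_vert hq, EuclideanSpace.inner_single_right]
  simp

theorem covector_momentum {q : Q} (hq : q ∈ φ.source) (α : Vert m π q →L[ℝ] ℝ) :
    φ.covector q (φ.momentum q α) = α := by
  ext w
  obtain ⟨u, rfl⟩ : ∃ u, w = φ.vert q u := ⟨_, (φ.vert_vertCoord hq w).symm⟩
  rw [covector_apply, φ.vertCoord_vert hq]
  have hu : u = ∑ i, u i • EuclideanSpace.single i (1 : ℝ) := by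
    simpa using ((EuclideanSpace.basisFun (Fin m) ℝ).sum_repr u).symm
  have h2 : α (φ.vert q u) = ∑ i, u i * α (φ.vert q (EuclideanSpace.single i 1)) := by
    conv_lhs => rw [hu, map_sum, map_sum]
    simp only [map_smul, smul_eq_mul]
  rw [h2, PiLp.inner_apply]
  rfl

/-- The holonomic coordinates `(t, q^i, p_i)` on the phase space. -/
def phase : PartialEquiv (VDual m π) ((ℝ × Eu m) × Eu m) where
  toFun z := (φ.toOpenPartialHomeomorph z.pt, φ.momentum z.pt z.cov)
  invFun y := ⟨φ.toOpenPartialHomeomorph.symm y.1, φ.covector _ y.2⟩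
  source := {z | z.pt ∈ φ.source}
  target := φ.target ×ˢ Set.univ
  map_source' z hz := ⟨φ.map_source hz, trivial⟩
  map_target' y hy := φ.map_target hy.1
  left_inv' z hz := by
    have key : ∀ q (_ : q = z.pt),
        (⟨q, φ.covector q (φ.momentum z.pt z.cov)⟩ : VDual m π) = z := by
      rintro _ rfl
      rw [φ.covector_momentum hz]
    exact key _ (φ.left_inv hz)
  right_inv' y hy := by
    have h' := φ.map_target hy.1
    ext1
    · exact φ.right_inv hy.1
    · exact φ.momentum_covector h' _

theorem jet_symm_trans [ConfigBundle m π] {y : (ℝ × Eu m) × Eu m} (hy : y.1 ∈ φ.overlap ψ) :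
    (φ.jet.symm.trans ψ.jet) y =
      (φ.trans ψ y.1, (fderiv ℝ (φ.trans ψ) y.1 (1, y.2)).2) := by
  have h := (φ.mem_overlap ψ).1 hy
  have h' := φ.map_target h.1
  change ψ.jet (φ.jet.invFun y) = _
  simp only [jet]
  rw [dif_pos h']
  ext1
  · rfl
  · change (ψ.tan _ (φ.frame _ _)).2 = _
    rw [φ.tan_frame_trans ψ h' h.2]
    have : φ.toOpenPartialHomeomorph (φ.toOpenPartialHomeomorph.symm y.1) = y.1 :=
      φ.right_inv h.1
    rw [this]

theorem phase_symm_trans {y : (ℝ × Eu m) × Eu m} (hy : y.1 ∈ φ.overlap ψ) :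
    (φ.phase.symm.trans ψ.phase) y =
      (φ.trans ψ y.1, WithLp.toLp 2 fun i => inner ℝ y.2
        (fderiv ℝ (ψ.trans φ) (φ.trans ψ y.1) (0, EuclideanSpace.single i 1)).2) := by
  have h := (φ.mem_overlap ψ).1 hy
  have h' := φ.map_target h.1
  ext1
  · rfl
  · ext i
    change inner ℝ y.2 (φ.tan _ (ψ.frame _ (0, EuclideanSpace.single i 1))).2 = _
    rw [ψ.tan_frame_trans φ h.2 h']
    rfl

theorem jet_trans_source [ConfigBundle m π] :
    (φ.jet.symm.trans ψ.jet).source = φ.overlap ψ ×ˢ Set.univ := by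
  ext y
  simp only [PartialEquiv.trans_source, PartialEquiv.symm_source, Set.mem_inter_iff,
    Set.mem_preimage, Set.mem_prod, Set.mem_univ, and_true, mem_overlap]
  change (y.1 ∈ φ.target ∧ True) ∧ (φ.jet.invFun y).pt ∈ ψ.source ↔ _
  have : (φ.jet.invFun y).pt = φ.toOpenPartialHomeomorph.symm y.1 := by
    simp only [jet]
    split_ifs <;> rfl
  rw [this]
  simp

theorem phase_trans_source :
    (φ.phase.symm.trans ψ.phase).source = φ.overlap ψ ×ˢ Set.univ := by
  ext y
  simp only [PartialEquiv.trans_source, PartialEquiv.symm_source, Set.mem_inter_iff,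
    Set.mem_preimage, Set.mem_prod, Set.mem_univ, and_true, mem_overlap]
  change (y.1 ∈ φ.target ∧ True) ∧ φ.toOpenPartialHomeomorph.symm y.1 ∈ ψ.source ↔ _
  simp

theorem mapsTo_overlap : Set.MapsTo (φ.trans ψ) (φ.overlap ψ) (ψ.overlap φ) := by
  intro x hx
  have h := (φ.mem_overlap ψ).1 hx
  rw [mem_overlap]
  refine ⟨ψ.map_source h.2, ?_⟩
  change ψ.toOpenPartialHomeomorph.symm (ψ.toOpenPartialHomeomorph _) ∈ _
  rw [ψ.left_inv h.2]
  exact φ.map_target h.1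

theorem contDiffOn_jet_trans [ConfigBundle m π] :
    ContDiffOn ℝ ∞ (φ.jet.symm.trans ψ.jet) (φ.jet.symm.trans ψ.jet).source := by
  rw [jet_trans_source]
  refine ContDiffOn.congr ?_ fun y hy => φ.jet_symm_trans ψ hy.1
  have h1 : ContDiffOn ℝ ∞ (fun y : (ℝ × Eu m) × Eu m => fderiv ℝ (φ.trans ψ) y.1)
      (φ.overlap ψ ×ˢ Set.univ) :=
    ((φ.contDiffOn_trans ψ).fderiv_of_isOpen (φ.isOpen_overlap ψ) (by simp)).comp
      contDiff_fst.contDiffOn fun y hy => hy.1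
  refine ContDiffOn.prodMk ((φ.contDiffOn_trans ψ).comp contDiff_fst.contDiffOn fun y hy => hy.1)
    (contDiff_snd.comp_contDiffOn (h1.clm_apply ?_))
  exact (contDiff_const.prodMk contDiff_snd).contDiffOn

theorem contDiffOn_phase_trans :
    ContDiffOn ℝ ∞ (φ.phase.symm.trans ψ.phase) (φ.phase.symm.trans ψ.phase).source := by
  rw [phase_trans_source]
  refine ContDiffOn.congr ?_ fun y hy => φ.phase_symm_trans ψ hy.1
  have h0 : ContDiffOn ℝ ∞ (fun y : (ℝ × Eu m) × Eu m => φ.trans ψ y.1)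
      (φ.overlap ψ ×ˢ Set.univ) :=
    (φ.contDiffOn_trans ψ).comp contDiff_fst.contDiffOn fun y hy => hy.1
  have h1 : ContDiffOn ℝ ∞ (fun y : (ℝ × Eu m) × Eu m => fderiv ℝ (ψ.trans φ) (φ.trans ψ y.1))
      (φ.overlap ψ ×ˢ Set.univ) :=
    ((ψ.contDiffOn_trans φ).fderiv_of_isOpen (ψ.isOpen_overlap φ) (by simp)).comp h0
      fun y hy => φ.mapsTo_overlap ψ hy.1
  refine h0.prodMk ?_
  rw [contDiffOn_piLp]
  intro i
  exact contDiff_snd.contDiffOn.inner ℝ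
    (contDiff_snd.comp_contDiffOn (h1.clm_apply contDiffOn_const))

end BundleChart

section Manifolds

variable (m π)

/-- The atlas of the velocity space `J¹Q` consisting of the adapted coordinates. -/
def jetCore [ConfigBundle m π] : ChartedSpaceCore ((ℝ × Eu m) × Eu m) (Jet1 m π) where
  atlas := Set.range fun φ : BundleChart m π => φ.jet
  chartAt j := (chartOf j.pt : BundleChart m π).jet
  mem_chart_source j := mem_chartOf_source j.pt
  chart_mem_atlas j := ⟨_, rfl⟩
  open_source := by
    rintro _ _ ⟨φ, rfl⟩ ⟨ψ, rfl⟩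
    dsimp only
    rw [φ.jet_trans_source ψ]
    exact (φ.isOpen_overlap ψ).prod isOpen_univ
  continuousOn_toFun := by
    rintro _ _ ⟨φ, rfl⟩ ⟨ψ, rfl⟩
    exact (φ.contDiffOn_jet_trans ψ).continuousOn

/-- The atlas of the phase space `V*Q` consisting of the holonomic coordinates. -/
def phaseCore [ConfigBundle m π] : ChartedSpaceCore ((ℝ × Eu m) × Eu m) (VDual m π) where
  atlas := Set.range fun φ : BundleChart m π => φ.phase
  chartAt j := (chartOf j.pt : BundleChart m π).phase
  mem_chart_source j := mem_chartOf_source j.pt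
  chart_mem_atlas j := ⟨_, rfl⟩
  open_source := by
    rintro _ _ ⟨φ, rfl⟩ ⟨ψ, rfl⟩
    dsimp only
    rw [φ.phase_trans_source ψ]
    exact (φ.isOpen_overlap ψ).prod isOpen_univ
  continuousOn_toFun := by
    rintro _ _ ⟨φ, rfl⟩ ⟨ψ, rfl⟩
    exact (φ.contDiffOn_phase_trans ψ).continuousOn

variable [ConfigBundle m π]

/- The manifold structures of `J¹Q` and `V*Q` are the ones for which the adapted coordinates are
diffeomorphisms onto open subsets. -/

instance : TopologicalSpace (Jet1 m π) := (jetCore m π).toTopologicalSpace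
instance : ChartedSpace ((ℝ × Eu m) × Eu m) (Jet1 m π) := (jetCore m π).toChartedSpace
instance : TopologicalSpace (VDual m π) := (phaseCore m π).toTopologicalSpace
instance : ChartedSpace ((ℝ × Eu m) × Eu m) (VDual m π) := (phaseCore m π).toChartedSpace

instance : IsManifold 𝓘(ℝ, (ℝ × Eu m) × Eu m) ∞ (Jet1 m π) := by
  refine isManifold_of_contDiffOn _ _ _ fun e e' he he' => ?_
  obtain ⟨_, he, he2⟩ := Set.mem_iUnion₂.1 he
  obtain ⟨φ, rfl⟩ := he
  obtain ⟨_, he', he2'⟩ := Set.mem_iUnion₂.1 he'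
  obtain ⟨ψ, rfl⟩ := he'
  rw [Set.mem_singleton_iff] at he2 he2'
  subst he2 he2'
  simpa using! φ.contDiffOn_jet_trans ψ

instance : IsManifold 𝓘(ℝ, (ℝ × Eu m) × Eu m) ∞ (VDual m π) := by
  refine isManifold_of_contDiffOn _ _ _ fun e e' he he' => ?_
  obtain ⟨_, he, he2⟩ := Set.mem_iUnion₂.1 he
  obtain ⟨φ, rfl⟩ := he
  obtain ⟨_, he', he2'⟩ := Set.mem_iUnion₂.1 he'
  obtain ⟨ψ, rfl⟩ := he'
  rw [Set.mem_singleton_iff] at he2 he2'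
  subst he2 he2'
  simpa using! φ.contDiffOn_phase_trans ψ

end Manifolds


section Mechanics

/-- The partial derivative `∂f/∂q^i` of a function of `(t, q^i, q^i_t)` or of `(t, q^i, p_i)`. -/
def baseDeriv (f : (ℝ × Eu m) × Eu m → ℝ) (i : Fin m) (y : (ℝ × Eu m) × Eu m) : ℝ :=
  fderiv ℝ f y ((0, EuclideanSpace.single i 1), 0)

/-- The partial derivative `∂f/∂q^i_t` of a function of `(t, q^i, q^i_t)`, respectively the
partial derivative `∂f/∂p_i` of a function of `(t, q^i, p_i)`. -/
def fibreDeriv (f : (ℝ × Eu m) × Eu m → ℝ) (i : Fin m) (y : (ℝ × Eu m) × Eu m) : ℝ :=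
  fderiv ℝ f y ((0, 0), EuclideanSpace.single i 1)

/-- The vector of all `fibreDeriv f i`. -/
def fibreGrad (f : (ℝ × Eu m) × Eu m → ℝ) (y : (ℝ × Eu m) × Eu m) : Eu m :=
  WithLp.toLp 2 fun i => fibreDeriv f i y

variable [ConfigBundle m π]

/-- The coordinate expression `ℒ(t, q^i, q^i_t)` of a Lagrangian `L = ℒ dt`, where the density
`ℒ` is a function on `J¹Q`. -/
def lagr (L : Jet1 m π → ℝ) (φ : BundleChart m π) : (ℝ × Eu m) × Eu m → ℝ :=
  fun y => L (φ.jet.symm y)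

/-- The Legendre map `L̂ : J¹Q → V*Q` over `Q`, given by `p_i ∘ L̂ = ∂ℒ/∂q^i_t`. By `phase_legendre`
below this holds in all fibred coordinates, not only in those used in the definition. -/
def legendre (L : Jet1 m π → ℝ) (j : Jet1 m π) : VDual m π :=
  let φ : BundleChart m π := chartOf j.pt
  ⟨j.pt, φ.covector j.pt (fibreGrad (lagr L φ) (φ.jet j))⟩

variable (m π)

/-- A Hamiltonian form `H = p_k dq^k - ℋ dt` on `V*Q`. It is the pull-back of the Liouville form by
a smooth section of `T*Q → V*Q`, which is the data recorded here: a covector `val z` at the base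
point of each `z` in `V*Q`, with restriction `z` to vertical vectors, hence
`val z = -ℋ(z) dt + p_k(z) dq^k` in coordinates. Smoothness is that of all local functions
`ℋ(t, q^i, p_i)`. -/
structure HamiltonianForm where
  val : ∀ z : VDual m π, TangentSpace 𝓘(ℝ, ℝ × Eu m) z.pt →L[ℝ] ℝ
  val_vert : ∀ (z : VDual m π) (w : Vert m π z.pt), val z w = z.cov w
  smooth : ∀ φ : BundleChart m π, ContDiffOn ℝ ∞
    (fun y : (ℝ × Eu m) × Eu m => -val (φ.phase.symm y) (φ.frame (φ.phase.symm y).pt (1, 0)))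
    (φ.target ×ˢ Set.univ)

variable {m π}

namespace HamiltonianForm

variable (H : HamiltonianForm m π)

/-- The local Hamiltonian `ℋ(t, q^i, p_i)` in the coordinates `φ`. -/
def ham (φ : BundleChart m π) : (ℝ × Eu m) × Eu m → ℝ :=
  fun y => -H.val (φ.phase.symm y) (φ.frame (φ.phase.symm y).pt (1, 0))

/-- The Hamiltonian map `Ĥ : V*Q → J¹Q` over `Q`, given by `q^i_t ∘ Ĥ = ∂ℋ/∂p_i`. By `jet_map`
below this holds in all fibred coordinates, not only in those used in the definition. -/
def map (z : VDual m π) : Jet1 m π :=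
  let φ : BundleChart m π := chartOf z.pt
  ⟨z.pt, φ.frame z.pt (1, fibreGrad (H.ham φ) (φ.phase z)),
    φ.dt_frame (mem_chartOf_source z.pt) _⟩

/-- The density of the Lagrangian `L_H = (p_i q^i_t - ℋ) dt` induced by `H`, as a function on
`V*Q ×_Q J¹Q`. -/
def inducedLagr (z : VDual m π) (v : TangentSpace 𝓘(ℝ, ℝ × Eu m) z.pt) : ℝ := H.val z v

end HamiltonianForm

theorem contDiffOn_lagr {L : Jet1 m π → ℝ}
    (hL : ContMDiff 𝓘(ℝ, (ℝ × Eu m) × Eu m) 𝓘(ℝ, ℝ) ∞ L) (φ : BundleChart m π) :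
    ContDiffOn ℝ ∞ (lagr L φ) (φ.target ×ˢ Set.univ) := by
  rw [← contMDiffOn_iff_contDiffOn]
  let e : OpenPartialHomeomorph (Jet1 m π) ((ℝ × Eu m) × Eu m) :=
    (jetCore m π).openPartialHomeomorph φ.jet ⟨φ, rfl⟩
  have he : e ∈ atlas ((ℝ × Eu m) × Eu m) (Jet1 m π) :=
    Set.mem_iUnion₂.2 ⟨φ.jet, ⟨φ, rfl⟩, rfl⟩
  have h1 := contMDiffOn_symm_of_mem_maximalAtlas (I := 𝓘(ℝ, (ℝ × Eu m) × Eu m)) (n := ∞)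
    (IsManifold.subset_maximalAtlas he)
  exact hL.comp_contMDiffOn h1

theorem fderiv_fibre {f : (ℝ × Eu m) × Eu m → ℝ} {y : (ℝ × Eu m) × Eu m}
    (hf : DifferentiableAt ℝ f y) (w : Eu m) :
    fderiv ℝ f y (0, w) = fderiv ℝ (fun v => f (y.1, v)) y.2 w := by
  have h : HasFDerivAt (fun v : Eu m => (y.1, v)) (ContinuousLinearMap.inr ℝ (ℝ × Eu m) (Eu m))
    y.2 := hasFDerivAt_prodMk_right y.1 y.2
  have := (HasFDerivAt.comp y.2 (f := fun v : Eu m => (y.1, v)) hf.hasFDerivAt h).fderiv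
  change fderiv ℝ (fun v => f (y.1, v)) y.2 = _ at this
  rw [this]
  rfl

theorem inner_fibreGrad (f : (ℝ × Eu m) × Eu m → ℝ) (y : (ℝ × Eu m) × Eu m) (w : Eu m) :
    inner ℝ (fibreGrad f y) w = fderiv ℝ f y (0, w) := by
  have hu : w = ∑ i, w i • EuclideanSpace.single i (1 : ℝ) := by
    simpa using ((EuclideanSpace.basisFun (Fin m) ℝ).sum_repr w).symm
  have : fderiv ℝ f y (0, w) = ∑ i, w i * fibreDeriv f i y := by
    have h2 : ((0 : ℝ × Eu m), w) = ContinuousLinearMap.inr ℝ (ℝ × Eu m) (Eu m) w := rfl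
    conv_lhs => rw [h2, hu, map_sum, map_sum]
    simp only [map_smul, smul_eq_mul]
    rfl
  rw [this, PiLp.inner_apply]
  rfl

/-- `p_i ∘ L̂ = ∂L/∂q^i_t` in all fibred coordinates. -/
theorem phase_legendre {L : Jet1 m π → ℝ}
    (hL : ContMDiff 𝓘(ℝ, (ℝ × Eu m) × Eu m) 𝓘(ℝ, ℝ) ∞ L) (φ : BundleChart m π) (j : Jet1 m π)
    (hj : j.pt ∈ φ.source) :
    φ.phase (legendre L j) =
      (φ.toOpenPartialHomeomorph j.pt, fibreGrad (lagr L φ) (φ.jet j)) := by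
  set ψ : BundleChart m π := chartOf j.pt with hψ
  have hj' : j.pt ∈ ψ.source := mem_chartOf_source j.pt
  have hd : ∀ χ : BundleChart m π, j.pt ∈ χ.source →
      DifferentiableAt ℝ (lagr L χ) (χ.jet j) := fun χ hχ =>
    ((contDiffOn_lagr hL χ).contDiffAt ((χ.open_target.prod isOpen_univ).mem_nhds
      ⟨χ.map_source hχ, trivial⟩)).differentiableAt (by simp)
  ext1
  · rfl
  · ext i
    change inner ℝ (fibreGrad (lagr L ψ) (ψ.jet j))
      (ψ.tan j.pt (φ.frame j.pt (0, EuclideanSpace.single i 1))).2 =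
      fderiv ℝ (lagr L φ) (φ.jet j) (0, EuclideanSpace.single i 1)
    rw [inner_fibreGrad, fderiv_fibre (hd ψ hj'), fderiv_fibre (hd φ hj)]
    let T : Eu m →L[ℝ] Eu m := (ContinuousLinearMap.snd ℝ ℝ (Eu m)).comp
      (((ψ.tan j.pt).comp (φ.frame j.pt)).comp (ContinuousLinearMap.inr ℝ ℝ (Eu m)))
    let b : Eu m := (ψ.tan j.pt (φ.frame j.pt (1, 0))).2
    have hT : ∀ v : Eu m, (ψ.tan j.pt (φ.frame j.pt (1, v))).2 = T v + b := by
      intro v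
      have : ((1 : ℝ), v) = (0, v) + (1, 0) := by simp
      rw [this, map_add, map_add]
      rfl
    have hmem : φ.toOpenPartialHomeomorph j.pt ∈ φ.overlap ψ :=
      (φ.mem_overlap ψ).2 ⟨φ.map_source hj, by rwa [φ.left_inv hj]⟩
    have hL2 : (fun v => lagr L φ ((φ.jet j).1, v)) =
        (fun v => lagr L ψ ((ψ.jet j).1, v)) ∘ fun v => T v + b := by
      funext v
      have h3 := φ.jet_symm_trans ψ (y := ((φ.jet j).1, v)) hmem
      have h4 : φ.jet.symm ((φ.jet j).1, v) ∈ ψ.jet.source := by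
        have : ((φ.jet j).1, v) ∈ (φ.jet.symm.trans ψ.jet).source := by
          rw [φ.jet_trans_source ψ]; exact ⟨hmem, trivial⟩
        exact this.2
      have h5 : ψ.jet (φ.jet.symm ((φ.jet j).1, v)) = ((ψ.jet j).1, T v + b) := by
        refine h3.trans ?_
        ext1
        · exact φ.trans_apply ψ hj
        · rw [← hT, φ.tan_frame_trans ψ hj hj']
          rfl
      change L (φ.jet.symm _) = L (ψ.jet.symm _)
      rw [← h5, ψ.jet.left_inv h4]
    have hv : (ψ.jet j).2 = T (φ.jet j).2 + b := by
      rw [← hT]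
      change (ψ.tan j.pt j.vec).2 = _
      have : ((1 : ℝ), (φ.jet j).2) = φ.tan j.pt j.vec := by
        ext1
        · rw [φ.tan_fst hj, j.dt_vec]
        · rfl
      rw [this, φ.frame_tan hj]
    have hd2 : DifferentiableAt ℝ (fun v => lagr L ψ ((ψ.jet j).1, v)) (T (φ.jet j).2 + b) := by
      rw [← hv]
      exact DifferentiableAt.comp (ψ.jet j).2 (f := fun v : Eu m => ((ψ.jet j).1, v)) (hd ψ hj')
        (hasFDerivAt_prodMk_right _ _).differentiableAt
    have hT' : HasFDerivAt (fun v => T v + b) T (φ.jet j).2 := T.hasFDerivAt.add_const b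
    rw [hL2, (HasFDerivAt.comp (φ.jet j).2 hd2.hasFDerivAt hT').fderiv, ← hv]
    rfl

/-- `q^i_t ∘ Ĥ = ∂ℋ/∂p_i` in all fibred coordinates. -/
theorem HamiltonianForm.jet_map (H : HamiltonianForm m π) (φ : BundleChart m π) (z : VDual m π)
    (hz : z.pt ∈ φ.source) :
    φ.jet (H.map z) = (φ.toOpenPartialHomeomorph z.pt, fibreGrad (H.ham φ) (φ.phase z)) := by
  set ψ : BundleChart m π := chartOf z.pt with hψ
  have hz' : z.pt ∈ ψ.source := mem_chartOf_source z.pt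
  have hd : ∀ χ : BundleChart m π, z.pt ∈ χ.source →
      DifferentiableAt ℝ (H.ham χ) (χ.phase z) := fun χ hχ =>
    ((H.smooth χ).contDiffAt ((χ.open_target.prod isOpen_univ).mem_nhds
      ⟨χ.map_source hχ, trivial⟩)).differentiableAt (by simp)
  have hpt : ∀ (χ : BundleChart m π), z.pt ∈ χ.source → ∀ p : Eu m,
      χ.phase.symm ((χ.phase z).1, p) = ⟨z.pt, χ.covector z.pt p⟩ := by
    intro χ hχ p
    have key : ∀ q, q = z.pt → (⟨q, χ.covector q p⟩ : VDual m π) = ⟨z.pt, χ.covector z.pt p⟩ := by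
      rintro _ rfl; rfl
    exact key _ (χ.left_inv hχ)
  have hham : ∀ (χ : BundleChart m π), z.pt ∈ χ.source → ∀ p : Eu m,
      H.ham χ ((χ.phase z).1, p) = -H.val ⟨z.pt, χ.covector z.pt p⟩ (χ.frame z.pt (1, 0)) := by
    intro χ hχ p
    unfold HamiltonianForm.ham
    rw [hpt χ hχ]
  ext1
  · rfl
  change (φ.tan z.pt (ψ.frame z.pt (1, fibreGrad (H.ham ψ) (ψ.phase z)))).2 = _
  let T : Eu m →L[ℝ] Eu m := (ContinuousLinearMap.snd ℝ ℝ (Eu m)).comp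
      (((φ.tan z.pt).comp (ψ.frame z.pt)).comp (ContinuousLinearMap.inr ℝ ℝ (Eu m)))
  let b : Eu m := (φ.tan z.pt (ψ.frame z.pt (1, 0))).2
  have hT : ∀ v : Eu m, (φ.tan z.pt (ψ.frame z.pt (1, v))).2 = T v + b := by
    intro v
    have : ((1 : ℝ), v) = (0, v) + (1, 0) := by simp
    rw [this, map_add, map_add]
    rfl
  rw [hT]
  let T' := ContinuousLinearMap.adjoint T
  have hmom : ∀ p : Eu m, ψ.momentum z.pt (φ.covector z.pt p) = T' p := by
    intro p
    ext i
    have : T' p i = inner ℝ (T' p) (EuclideanSpace.single i (1 : ℝ)) := by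
      rw [EuclideanSpace.inner_single_right]; simp
    rw [this, ContinuousLinearMap.adjoint_inner_left]
    rfl
  have hcov : ∀ p : Eu m, φ.covector z.pt p = ψ.covector z.pt (T' p) := by
    intro p
    rw [← hmom, ψ.covector_momentum hz']
  have hH : (fun p => H.ham φ ((φ.phase z).1, p)) =
      fun p => H.ham ψ ((ψ.phase z).1, T' p) + inner ℝ b p := by
    funext p
    rw [hham φ hz, hham ψ hz', hcov]
    have hu : dt m π z.pt (ψ.frame z.pt (1, 0) - φ.frame z.pt (1, 0)) = 0 := by
      rw [map_sub, ψ.dt_frame hz', φ.dt_frame hz]; simp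
    have h1 := H.val_vert ⟨z.pt, ψ.covector z.pt (T' p)⟩ ⟨_, hu⟩
    rw [← hcov p] at h1 ⊢
    simp only [map_sub, φ.covector_apply] at h1
    have h2 : φ.vertCoord z.pt ⟨_, hu⟩ = b := by
      change (φ.tan z.pt (_ - _)).2 = _
      rw [map_sub, φ.tan_frame hz, Prod.snd_sub]
      exact sub_zero _
    rw [h2, real_inner_comm] at h1
    linarith
  have hp : (ψ.phase z).2 = T' (φ.phase z).2 := by
    rw [← hmom]
    change _ = ψ.momentum z.pt (φ.covector z.pt (φ.momentum z.pt z.cov))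
    rw [φ.covector_momentum hz]
    rfl
  have hd2 : DifferentiableAt ℝ (fun v => H.ham ψ ((ψ.phase z).1, v)) (T' (φ.phase z).2) := by
    rw [← hp]
    exact DifferentiableAt.comp (ψ.phase z).2 (f := fun v : Eu m => ((ψ.phase z).1, v)) (hd ψ hz')
      (hasFDerivAt_prodMk_right _ _).differentiableAt
  refine ext_inner_right ℝ fun w => ?_
  rw [inner_fibreGrad, fderiv_fibre (hd φ hz), hH]
  have e1 : HasFDerivAt (fun p => H.ham ψ ((ψ.phase z).1, T' p)) _ (φ.phase z).2 :=
    HasFDerivAt.comp (g := fun v => H.ham ψ ((ψ.phase z).1, v)) (φ.phase z).2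
      hd2.hasFDerivAt T'.hasFDerivAt
  have e2 : HasFDerivAt (fun p => inner ℝ b p) (innerSL ℝ b) (φ.phase z).2 :=
    (innerSL ℝ b).hasFDerivAt
  rw [(e1.fun_add e2).fderiv, ← hp]
  change _ = fderiv ℝ _ _ (T' w) + inner ℝ b w
  rw [← fderiv_fibre (hd ψ hz'), ← inner_fibreGrad, ContinuousLinearMap.adjoint_inner_right,
    inner_add_left]


/-- The Lagrangian constraint space `N_L = L̂(J¹Q)`. -/
def constraintSpace (L : Jet1 m π → ℝ) : Set (VDual m π) := Set.range (legendre L)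

/-- The Legendre map as a map `J¹Q → N_L`. -/
def legendreOnto (L : Jet1 m π → ℝ) (j : Jet1 m π) : constraintSpace L :=
  ⟨legendre L j, j, rfl⟩

/-- Almost regular Lagrangians: `N_L` is a closed imbedded subbundle of `V*Q → Q`, and the Legendre
map `J¹Q → N_L` is a fibred manifold (a surjective submersion) with connected fibres. -/
structure IsAlmostRegular (L : Jet1 m π → ℝ) : Prop where
  isClosed : IsClosed (constraintSpace L)
  subbundle : ∃ (n : ℕ) (_ : ChartedSpace (Eu n) (constraintSpace L)),
    IsManifold 𝓘(ℝ, Eu n) ∞ (constraintSpace L) ∧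
    Manifold.IsSmoothEmbedding 𝓘(ℝ, Eu n) 𝓘(ℝ, (ℝ × Eu m) × Eu m) ∞
      (Subtype.val : constraintSpace L → VDual m π) ∧
    (∃ k : ℕ, IsSmoothFibreBundle 𝓘(ℝ, ℝ × Eu m) 𝓘(ℝ, Eu n) k
      (fun z : constraintSpace L => z.1.pt)) ∧
    Manifold.IsSubmersion 𝓘(ℝ, (ℝ × Eu m) × Eu m) 𝓘(ℝ, Eu n) ∞ (legendreOnto L)
  connected : ∀ z ∈ constraintSpace L, IsConnected (legendre L ⁻¹' {z})

/-- `H` is weakly associated with `L`: `L̂ ∘ Ĥ ∘ L̂ = L̂`, and `Ĥ^* L_H = Ĥ^* L` on `N_L`. -/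
structure IsWeaklyAssociated (H : HamiltonianForm m π) (L : Jet1 m π → ℝ) : Prop where
  legendre_map_legendre : ∀ j, legendre L (H.map (legendre L j)) = legendre L j
  pullback_eq : ∀ z ∈ constraintSpace L, H.inducedLagr z (H.map z).vec = L (H.map z)

/-- `s` restricted to `U` is a (local) smooth section of `p : Y → ℝ`. -/
structure IsSectionOn {EY HY Y : Type*} [NormedAddCommGroup EY] [NormedSpace ℝ EY]
    [TopologicalSpace HY] [TopologicalSpace Y] [ChartedSpace HY Y]
    (IY : ModelWithCorners ℝ EY HY) (p : Y → ℝ) (s : ℝ → Y) (U : Set ℝ) : Prop where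
  smooth : ContMDiffOn 𝓘(ℝ, ℝ) IY ∞ s U
  section_eq : ∀ t ∈ U, p (s t) = t

/-- The section `r` of `V*Q → ℝ` over `U` is a solution of the Hamilton equation
`dq^i/dt = ∂ℋ/∂p_i`, `dp_i/dt = -∂ℋ/∂q^i`. -/
structure IsHamiltonSolution (H : HamiltonianForm m π) (r : ℝ → VDual m π) (U : Set ℝ) :
    Prop where
  isSection : IsSectionOn 𝓘(ℝ, (ℝ × Eu m) × Eu m) (fun z : VDual m π => π z.pt) r U
  equation : ∀ φ : BundleChart m π, ∀ t ∈ U, (r t).pt ∈ φ.source → ∀ i : Fin m,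
    HasDerivAt (fun τ => (φ.phase (r τ)).1.2 i) (fibreDeriv (H.ham φ) i (φ.phase (r t))) t ∧
    HasDerivAt (fun τ => (φ.phase (r τ)).2 i) (-baseDeriv (H.ham φ) i (φ.phase (r t))) t

/-- The coordinates `(t, q^i(t), dq^i/dt)` of the jet prolongation of a section `s` of `Q → ℝ`. -/
def prolongCoord (φ : BundleChart m π) (s : ℝ → Q) (t : ℝ) : (ℝ × Eu m) × Eu m :=
  (φ.toOpenPartialHomeomorph (s t), deriv (fun τ => (φ.toOpenPartialHomeomorph (s τ)).2) t)

/-- The section `s` of `Q → ℝ` over `U` is a solution of the Lagrange equation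
`∂ℒ/∂q^i - d/dt (∂ℒ/∂q^i_t) = 0`. -/
structure IsLagrangeSolution (L : Jet1 m π → ℝ) (s : ℝ → Q) (U : Set ℝ) : Prop where
  isSection : IsSectionOn 𝓘(ℝ, ℝ × Eu m) π s U
  equation : ∀ φ : BundleChart m π, ∀ t ∈ U, s t ∈ φ.source → ∀ i : Fin m,
    HasDerivAt (fun τ => fibreDeriv (lagr L φ) i (prolongCoord φ s τ))
      (baseDeriv (lagr L φ) i (prolongCoord φ s t)) t

/-- The section `c = (t, q^i(t), v^i(t))` of `J¹Q → ℝ` over `U` is a solution of the Cartan equation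
`∂π_j/∂q^i_t (dq^j/dt - v^j) = 0`,
`∂ℒ/∂q^i - d/dt π_i + ∂π_j/∂q^i (dq^j/dt - v^j) = 0`, where `π_j = ∂ℒ/∂q^j_t`. -/
structure IsCartanSolution (L : Jet1 m π → ℝ) (c : ℝ → Jet1 m π) (U : Set ℝ) : Prop where
  isSection : IsSectionOn 𝓘(ℝ, (ℝ × Eu m) × Eu m) (fun j : Jet1 m π => π j.pt) c U
  equation₁ : ∀ φ : BundleChart m π, ∀ t ∈ U, (c t).pt ∈ φ.source → ∀ i : Fin m,
    ∑ j, fibreDeriv (fibreDeriv (lagr L φ) j) i (φ.jet (c t)) *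
      (deriv (fun τ => (φ.jet (c τ)).1.2) t j - (φ.jet (c t)).2 j) = 0
  equation₂ : ∀ φ : BundleChart m π, ∀ t ∈ U, (c t).pt ∈ φ.source → ∀ i : Fin m,
    HasDerivAt (fun τ => fibreDeriv (lagr L φ) i (φ.jet (c τ)))
      (baseDeriv (lagr L φ) i (φ.jet (c t)) +
        ∑ j, baseDeriv (fibreDeriv (lagr L φ) j) i (φ.jet (c t)) *
          (deriv (fun τ => (φ.jet (c τ)).1.2) t j - (φ.jet (c t)).2 j)) t

end Mechanics

end Config
end TimeMech
end

open TimeMech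

/-!
Everything happens in one system of fibred coordinates `(t, q, p)`. For a Hamilton solution
`r = (t, q, p)` the equation `dq/dt = ∂ℋ/∂p` says that `Ĥ ∘ r` is the jet prolongation of the
projection of `r` to `Q` (`prolongCoord_eq_jet_map`). Since `r` lies in `N_L`, the identity
`L̂ ∘ Ĥ ∘ L̂ = L̂` gives `L̂ ∘ Ĥ ∘ r = r`, that is, `π_i = p_i` along the prolongation, whose time
derivative is `-∂ℋ/∂q^i`. So the Lagrange equation amounts to `∂ℒ/∂q^i (Ĥ z) = -∂ℋ/∂q^i (z)` at the
points `z` of `N_L` (`baseDeriv_lagr_map`).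

This is an envelope argument (`fderiv_base_add_eq_zero`): pull the identity
`p ∂ℋ/∂p - ℋ = ℒ(t, q, ∂ℋ/∂p)`, which holds on `N_L`, back along `x ↦ L̂(x, v)` with the velocity
`v` of `Ĥ z` held fixed, and differentiate in `x = (t, q)`. The variation of `p` cancels because
`∂ℋ/∂p = v`, the variation of the velocity `∂ℋ/∂p` cancels because `∂ℒ/∂q_t = p` at `Ĥ z`, and what
remains is `∂ℋ/∂x + ∂ℒ/∂x = 0`. Pulling back to `J¹Q` avoids differentiating along `N_L` itself.

The Cartan equation is then the Lagrange equation, as its terms with `dq/dt - v` vanish.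
-/

open scoped Topology

namespace TimeMech

universe u

variable {m : ℕ}

/-! ### Calculus in fibred coordinates -/

theorem contDiffOn_fibreGrad {f : (ℝ × Eu m) × Eu m → ℝ} {s : Set ((ℝ × Eu m) × Eu m)}
    (hs : IsOpen s) (hf : ContDiffOn ℝ ∞ f s) : ContDiffOn ℝ ∞ (fibreGrad f) s := by
  rw [contDiffOn_piLp]
  intro i
  exact (hf.fderiv_of_isOpen hs (by simp)).clm_apply contDiffOn_const

theorem fderiv_eq_base_add_fibre (f : (ℝ × Eu m) × Eu m → ℝ) (y : (ℝ × Eu m) × Eu m)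
    (w : ℝ × Eu m) (u : Eu m) :
    fderiv ℝ f y (w, u) = fderiv ℝ f y (w, 0) + inner ℝ (fibreGrad f y) u := by
  rw [inner_fibreGrad, ← map_add]
  simp

/-- The envelope argument: if `h` is near `x₀` the Legendre transform of `f` along the momenta
`x ↦ fibreGrad f (x, v₀)`, then the base derivatives of `f` and `h` at corresponding points are
opposite. -/
theorem fderiv_base_add_eq_zero {f h : (ℝ × Eu m) × Eu m → ℝ} {x₀ : ℝ × Eu m} {v₀ p₀ : Eu m}
    (hf : DifferentiableAt ℝ f (x₀, v₀)) (hf' : DifferentiableAt ℝ (fibreGrad f) (x₀, v₀))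
    (hh : DifferentiableAt ℝ h (x₀, p₀)) (hh' : DifferentiableAt ℝ (fibreGrad h) (x₀, p₀))
    (hp : fibreGrad f (x₀, v₀) = p₀) (hv : fibreGrad h (x₀, p₀) = v₀)
    (hE : ∀ᶠ x in 𝓝 x₀,
      inner ℝ (fibreGrad f (x, v₀)) (fibreGrad h (x, fibreGrad f (x, v₀))) -
        h (x, fibreGrad f (x, v₀)) = f (x, fibreGrad h (x, fibreGrad f (x, v₀))))
    (w : ℝ × Eu m) : fderiv ℝ h (x₀, p₀) (w, 0) + fderiv ℝ f (x₀, v₀) (w, 0) = 0 := by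
  let P : ℝ × Eu m → Eu m := fun x => fibreGrad f (x, v₀)
  let V : ℝ × Eu m → Eu m := fun x => fibreGrad h (x, P x)
  have hP0 : P x₀ = p₀ := hp
  have hV0 : V x₀ = v₀ := by change fibreGrad h (x₀, P x₀) = v₀; rw [hP0, hv]
  have hP : DifferentiableAt ℝ P x₀ :=
    DifferentiableAt.comp x₀ (f := fun x => (x, v₀)) hf' (by fun_prop)
  have hV : DifferentiableAt ℝ V x₀ :=
    DifferentiableAt.comp x₀ (f := fun x => (x, P x)) (by rw [hP0]; exact hh') (by fun_prop)
  have eh : HasFDerivAt (fun x => h (x, P x)) _ x₀ :=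
    HasFDerivAt.comp x₀ (f := fun x => (x, P x)) (by rw [hP0]; exact hh.hasFDerivAt)
      ((hasFDerivAt_id x₀).prodMk hP.hasFDerivAt)
  have ef : HasFDerivAt (fun x => f (x, V x)) _ x₀ :=
    HasFDerivAt.comp x₀ (f := fun x => (x, V x)) (by rw [hV0]; exact hf.hasFDerivAt)
      ((hasFDerivAt_id x₀).prodMk hV.hasFDerivAt)
  have e := (((hP.hasFDerivAt.inner ℝ hV.hasFDerivAt).sub eh).congr_of_eventuallyEq
    (hE.mono fun x hx => hx.symm)).unique ef
  have e' := congrArg (fun A : (ℝ × Eu m) →L[ℝ] ℝ => A w) e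
  change inner ℝ (P x₀) (fderiv ℝ V x₀ w) + inner ℝ (fderiv ℝ P x₀ w) (V x₀) -
    fderiv ℝ h (x₀, p₀) (w, fderiv ℝ P x₀ w) = fderiv ℝ f (x₀, v₀) (w, fderiv ℝ V x₀ w) at e'
  rw [fderiv_eq_base_add_fibre h, fderiv_eq_base_add_fibre f, hp, hv, hP0, hV0,
    real_inner_comm] at e'
  rw [real_inner_comm v₀] at e'
  linarith

variable {Q : Type u} [TopologicalSpace Q] [ChartedSpace (ℝ × Eu m) Q] {π : Q → ℝ}

/-! ### Smooth maps between the bundles -/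

namespace BundleChart

variable (φ : BundleChart m π)

theorem isOpen_target_prod : IsOpen (φ.target ×ˢ (Set.univ : Set (Eu m))) :=
  φ.open_target.prod isOpen_univ

variable [ConfigBundle m π]

theorem isOpen_phase_source : IsOpen φ.phase.source :=
  ((phaseCore m π).openPartialHomeomorph φ.phase ⟨φ, rfl⟩).open_source

theorem contMDiffOn_phase :
    ContMDiffOn 𝓘(ℝ, (ℝ × Eu m) × Eu m) 𝓘(ℝ, (ℝ × Eu m) × Eu m) ∞ φ.phase φ.phase.source := by
  let e : OpenPartialHomeomorph (VDual m π) ((ℝ × Eu m) × Eu m) :=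
    (phaseCore m π).openPartialHomeomorph φ.phase ⟨φ, rfl⟩
  have he : e ∈ atlas ((ℝ × Eu m) × Eu m) (VDual m π) :=
    Set.mem_iUnion₂.2 ⟨φ.phase, ⟨φ, rfl⟩, rfl⟩
  exact contMDiffOn_of_mem_maximalAtlas (I := 𝓘(ℝ, (ℝ × Eu m) × Eu m)) (n := ∞)
    (IsManifold.subset_maximalAtlas he)

theorem contMDiffOn_jet_symm :
    ContMDiffOn 𝓘(ℝ, (ℝ × Eu m) × Eu m) 𝓘(ℝ, (ℝ × Eu m) × Eu m) ∞ φ.jet.symm φ.jet.target := by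
  let e : OpenPartialHomeomorph (Jet1 m π) ((ℝ × Eu m) × Eu m) :=
    (jetCore m π).openPartialHomeomorph φ.jet ⟨φ, rfl⟩
  have he : e ∈ atlas ((ℝ × Eu m) × Eu m) (Jet1 m π) :=
    Set.mem_iUnion₂.2 ⟨φ.jet, ⟨φ, rfl⟩, rfl⟩
  exact contMDiffOn_symm_of_mem_maximalAtlas (I := 𝓘(ℝ, (ℝ × Eu m) × Eu m)) (n := ∞)
    (IsManifold.subset_maximalAtlas he)

end BundleChart

variable [ConfigBundle m π]

theorem VDual.contMDiff_pt :
    ContMDiff 𝓘(ℝ, (ℝ × Eu m) × Eu m) 𝓘(ℝ, ℝ × Eu m) ∞ (VDual.pt : VDual m π → Q) := by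
  intro z
  let φ : BundleChart m π := chartOf z.pt
  have hz : z ∈ φ.phase.source := mem_chartOf_source z.pt
  have h : ContMDiffOn 𝓘(ℝ, (ℝ × Eu m) × Eu m) 𝓘(ℝ, ℝ × Eu m) ∞
      (fun x : VDual m π => φ.toOpenPartialHomeomorph.symm (φ.phase x).1) φ.phase.source :=
    φ.smooth_symm.comp (contDiff_fst.contMDiff.comp_contMDiffOn φ.contMDiffOn_phase)
      fun x hx => φ.map_source hx
  exact (h.congr fun x hx => (φ.left_inv hx).symm).contMDiffAt
    (φ.isOpen_phase_source.mem_nhds hz)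

theorem HamiltonianForm.contMDiff_map (H : HamiltonianForm m π) :
    ContMDiff 𝓘(ℝ, (ℝ × Eu m) × Eu m) 𝓘(ℝ, (ℝ × Eu m) × Eu m) ∞ H.map := by
  intro z
  let φ : BundleChart m π := chartOf z.pt
  have hz : z ∈ φ.phase.source := mem_chartOf_source z.pt
  have hg : ContMDiffOn 𝓘(ℝ, (ℝ × Eu m) × Eu m) 𝓘(ℝ, (ℝ × Eu m) × Eu m) ∞
      (fun y : (ℝ × Eu m) × Eu m => (y.1, fibreGrad (H.ham φ) y)) (φ.target ×ˢ Set.univ) :=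
    (contDiff_fst.contDiffOn.prodMk
      (contDiffOn_fibreGrad φ.isOpen_target_prod (H.smooth φ))).contMDiffOn
  have h := φ.contMDiffOn_jet_symm.comp
    (hg.comp φ.contMDiffOn_phase fun x hx => φ.phase.map_source hx)
    fun x hx => ⟨φ.map_source hx, trivial⟩
  refine (h.congr fun x hx => ?_).contMDiffAt (φ.isOpen_phase_source.mem_nhds hz)
  have hx' : H.map x ∈ φ.jet.source := hx
  rw [← φ.jet.left_inv hx', H.jet_map φ x hx]
  rfl

/-! ### Weak association in coordinates -/

/-- The induced Lagrangian `p_i q^i_t - ℋ` in coordinates. -/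
theorem HamiltonianForm.inducedLagr_map (H : HamiltonianForm m π) (φ : BundleChart m π)
    (z : VDual m π) (hz : z.pt ∈ φ.source) :
    H.inducedLagr z (H.map z).vec =
      inner ℝ (φ.phase z).2 (fibreGrad (H.ham φ) (φ.phase z)) - H.ham φ (φ.phase z) := by
  set v := fibreGrad (H.ham φ) (φ.phase z)
  have hvec : (H.map z).vec = φ.frame z.pt (1, 0) + (φ.vert z.pt v).1 := by
    have h1 : φ.tan z.pt (H.map z).vec = (1, v) :=
      Prod.ext ((φ.tan_fst hz _).trans (H.map z).dt_vec)
        (congrArg (fun y : (ℝ × Eu m) × Eu m => y.2) (H.jet_map φ z hz))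
    have h2 : ((1 : ℝ), v) = (1, 0) + (0, v) := by simp
    rw [h2] at h1
    have h3 := φ.frame_tan hz (H.map z).vec
    rw [h1, map_add] at h3
    exact h3.symm
  have hham : H.ham φ (φ.phase z) = -H.val z (φ.frame z.pt (1, 0)) := by
    unfold HamiltonianForm.ham
    rw [φ.phase.left_inv hz]
  have hcov : z.cov (φ.vert z.pt v) = inner ℝ (φ.phase z).2 v := by
    conv_lhs => rw [← φ.covector_momentum hz z.cov, φ.covector_apply, φ.vertCoord_vert hz]
    rfl
  unfold HamiltonianForm.inducedLagr
  rw [hvec, map_add, H.val_vert, hcov, hham]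
  ring

theorem IsWeaklyAssociated.legendre_map {H : HamiltonianForm m π} {L : Jet1 m π → ℝ}
    (hH : IsWeaklyAssociated H L) {z : VDual m π} (hz : z ∈ constraintSpace L) :
    legendre L (H.map z) = z := by
  obtain ⟨j, rfl⟩ := hz
  exact hH.legendre_map_legendre j

/-- `π_i ∘ Ĥ = p_i` on `N_L`. -/
theorem fibreGrad_lagr_map {L : Jet1 m π → ℝ}
    (hL : ContMDiff 𝓘(ℝ, (ℝ × Eu m) × Eu m) 𝓘(ℝ, ℝ) ∞ L) {H : HamiltonianForm m π}
    (hH : IsWeaklyAssociated H L) (φ : BundleChart m π) {z : VDual m π}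
    (hz : z ∈ constraintSpace L) (hφ : z.pt ∈ φ.source) :
    fibreGrad (lagr L φ) (φ.jet (H.map z)) = (φ.phase z).2 := by
  have h := phase_legendre hL φ (H.map z) hφ
  rw [hH.legendre_map hz] at h
  exact (congrArg Prod.snd h).symm

/-- `∂ℒ/∂q^i ∘ Ĥ = -∂ℋ/∂q^i` on `N_L`. -/
theorem baseDeriv_lagr_map {L : Jet1 m π → ℝ}
    (hL : ContMDiff 𝓘(ℝ, (ℝ × Eu m) × Eu m) 𝓘(ℝ, ℝ) ∞ L) {H : HamiltonianForm m π}
    (hH : IsWeaklyAssociated H L) (φ : BundleChart m π) {z : VDual m π}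
    (hz : z ∈ constraintSpace L) (hφ : z.pt ∈ φ.source) (i : Fin m) :
    baseDeriv (lagr L φ) i (φ.jet (H.map z)) = -baseDeriv (H.ham φ) i (φ.phase z) := by
  have hp := fibreGrad_lagr_map hL hH φ hz hφ
  have hO : IsOpen (φ.target ×ˢ (Set.univ : Set (Eu m))) := φ.isOpen_target_prod
  have hx : (φ.phase z).1 ∈ φ.target := φ.map_source hφ
  have hdiff : ∀ {E : Type} [NormedAddCommGroup E] [NormedSpace ℝ E]
      {g : (ℝ × Eu m) × Eu m → E} (_ : ContDiffOn ℝ ∞ g (φ.target ×ˢ Set.univ)) (v : Eu m),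
      DifferentiableAt ℝ g ((φ.phase z).1, v) := fun hg v =>
    (hg.contDiffAt (x := ((φ.phase z).1, v)) (hO.mem_nhds ⟨hx, trivial⟩)).differentiableAt (by simp)
  have hjet : φ.jet (H.map z) = ((φ.phase z).1, fibreGrad (H.ham φ) (φ.phase z)) :=
    H.jet_map φ z hφ
  rw [hjet] at hp ⊢
  have key := fderiv_base_add_eq_zero
    (hdiff (contDiffOn_lagr hL φ) (fibreGrad (H.ham φ) (φ.phase z)))
    (hdiff (contDiffOn_fibreGrad hO (contDiffOn_lagr hL φ)) _)
    (hdiff (H.smooth φ) (φ.phase z).2)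
    (hdiff (contDiffOn_fibreGrad hO (H.smooth φ)) (φ.phase z).2) hp rfl ?_
    (0, EuclideanSpace.single i 1)
  · exact eq_neg_of_add_eq_zero_right key
  · filter_upwards [φ.open_target.mem_nhds hx] with x hx
    set v := fibreGrad (H.ham φ) (φ.phase z)
    -- The point of `N_L` over `x` that corresponds to the frozen velocity `v`.
    let j : Jet1 m π := φ.jet.symm (x, v)
    have hjt : (x, v) ∈ φ.jet.target := ⟨hx, trivial⟩
    have hj : j.pt ∈ φ.source := φ.jet.map_target hjt
    have hjv : φ.jet j = (x, v) := φ.jet.right_inv hjt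
    have hjx : φ.toOpenPartialHomeomorph j.pt = x := congrArg Prod.fst hjv
    have hph : φ.phase (legendre L j) = (x, fibreGrad (lagr L φ) (x, v)) := by
      rw [phase_legendre hL φ j hj, hjv, hjx]
    have h1 := hH.pullback_eq (legendre L j) ⟨j, rfl⟩
    rw [H.inducedLagr_map φ _ hj, hph] at h1
    have h2 : φ.jet (H.map (legendre L j)) =
        (x, fibreGrad (H.ham φ) (φ.phase (legendre L j))) := by
      rw [H.jet_map φ (legendre L j) hj]
      exact congrArg₂ Prod.mk hjx rfl
    have h3 : H.map (legendre L j) ∈ φ.jet.source := hj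
    rw [hph] at h2
    exact h1.trans (congrArg L ((φ.jet.left_inv h3).symm.trans (congrArg φ.jet.symm h2)))

/-! ### Solutions of the Hamilton equation -/

namespace IsHamiltonSolution

variable {H : HamiltonianForm m π} {r : ℝ → VDual m π} {U : Set ℝ}

theorem hasDerivAt_coord (hr : IsHamiltonSolution H r U) (φ : BundleChart m π) {t : ℝ}
    (ht : t ∈ U) (hφ : (r t).pt ∈ φ.source) :
    HasDerivAt (fun τ => (φ.phase (r τ)).1.2) (fibreGrad (H.ham φ) (φ.phase (r t))) t := by
  rw [hasDerivAt_iff_hasFDerivAt, ← hasFDerivWithinAt_univ, hasFDerivWithinAt_euclidean]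
  intro i
  convert! (hr.equation φ t ht hφ i).1.hasFDerivAt.hasFDerivWithinAt using 1

/-- The prolongation of the projection of a Hamilton solution `r` is `Ĥ ∘ r`. -/
theorem prolongCoord_eq_jet_map (hr : IsHamiltonSolution H r U) (φ : BundleChart m π) {t : ℝ}
    (ht : t ∈ U) (hφ : (r t).pt ∈ φ.source) :
    prolongCoord φ (fun τ => (r τ).pt) t = φ.jet (H.map (r t)) := by
  rw [H.jet_map φ (r t) hφ]
  exact congrArg (Prod.mk _) (hr.hasDerivAt_coord φ ht hφ).deriv

theorem deriv_coord_sub (hr : IsHamiltonSolution H r U) (φ : BundleChart m π) {t : ℝ}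
    (ht : t ∈ U) (hφ : (r t).pt ∈ φ.source) (j : Fin m) :
    deriv (fun τ => (φ.jet (H.map (r τ))).1.2) t j - (φ.jet (H.map (r t))).2 j = 0 := by
  rw [H.jet_map φ (r t) hφ]
  exact sub_eq_zero.2 (congrArg (fun v : Eu m => v j) (hr.hasDerivAt_coord φ ht hφ).deriv)

theorem eventually_mem (hr : IsHamiltonSolution H r U) (hU : IsOpen U) (φ : BundleChart m π)
    {t : ℝ} (ht : t ∈ U) (hφ : (r t).pt ∈ φ.source) :
    ∀ᶠ τ in 𝓝 t, τ ∈ U ∧ (r τ).pt ∈ φ.source := by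
  have hc : ContinuousAt r t := hr.isSection.smooth.continuousOn.continuousAt (hU.mem_nhds ht)
  exact (hU.eventually_mem ht).and (hc.eventually (φ.isOpen_phase_source.mem_nhds hφ))

/-- The Lagrange equation along `Ĥ ∘ r`. -/
theorem hasDerivAt_momentum (hr : IsHamiltonSolution H r U) {L : Jet1 m π → ℝ}
    (hL : ContMDiff 𝓘(ℝ, (ℝ × Eu m) × Eu m) 𝓘(ℝ, ℝ) ∞ L) (hH : IsWeaklyAssociated H L)
    (hU : IsOpen U) (hN : ∀ t ∈ U, r t ∈ constraintSpace L) (φ : BundleChart m π) {t : ℝ}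
    (ht : t ∈ U) (hφ : (r t).pt ∈ φ.source) (i : Fin m) :
    HasDerivAt (fun τ => fibreDeriv (lagr L φ) i (φ.jet (H.map (r τ))))
      (baseDeriv (lagr L φ) i (φ.jet (H.map (r t)))) t := by
  rw [baseDeriv_lagr_map hL hH φ (hN t ht) hφ]
  refine (hr.equation φ t ht hφ i).2.congr_of_eventuallyEq ?_
  filter_upwards [hr.eventually_mem hU φ ht hφ] with τ hτ
  exact congrArg (fun v : Eu m => v i) (fibreGrad_lagr_map hL hH φ (hN τ hτ.1) hτ.2)

end IsHamiltonSolution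

end TimeMech

theorem theorem3p3 {m : ℕ} {Q : Type*} [TopologicalSpace Q] [T2Space Q]
    [SecondCountableTopology Q] [ChartedSpace (ℝ × Eu m) Q]
    [IsManifold 𝓘(ℝ, ℝ × Eu m) ∞ Q] (π : Q → ℝ) [ConfigBundle m π]
    (L : Jet1 m π → ℝ) (hL : ContMDiff 𝓘(ℝ, (ℝ × Eu m) × Eu m) 𝓘(ℝ, ℝ) ∞ L)
    (hreg : IsAlmostRegular L)
    (H : HamiltonianForm m π) (hH : IsWeaklyAssociated H L)
    (U : Set ℝ) (hU : IsOpen U) (r : ℝ → VDual m π)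
    (hr : IsHamiltonSolution H r U) (hN : ∀ t ∈ U, r t ∈ constraintSpace L) :
    IsLagrangeSolution L (fun t => (r t).pt) U ∧
      IsCartanSolution L (fun t => H.map (r t)) U := by
  refine ⟨⟨⟨VDual.contMDiff_pt.comp_contMDiffOn hr.isSection.smooth, hr.isSection.section_eq⟩,
    fun φ t ht hφ i => ?_⟩,
    ⟨⟨H.contMDiff_map.comp_contMDiffOn hr.isSection.smooth, hr.isSection.section_eq⟩,
      fun φ t ht hφ i => ?_, fun φ t ht hφ i => ?_⟩⟩
  · rw [hr.prolongCoord_eq_jet_map φ ht hφ]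
    refine (hr.hasDerivAt_momentum hL hH hU hN φ ht hφ i).congr_of_eventuallyEq ?_
    filter_upwards [hr.eventually_mem hU φ ht hφ] with τ hτ
    rw [hr.prolongCoord_eq_jet_map φ hτ.1 hτ.2]
  · exact Finset.sum_eq_zero fun j _ => by rw [hr.deriv_coord_sub φ ht hφ, mul_zero]
  · rw [Finset.sum_eq_zero fun j _ => by rw [hr.deriv_coord_sub φ ht hφ, mul_zero], add_zero]
    exact hr.hasDerivAt_momentum hL hH hU hN φ ht hφ i
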